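/- Let $G$ be a simple biconnected planar cubic graph with $2n$ vertices that is not bipartite. A Tait coloring of $G$ is a coloring of its edges in 3 colors such that any two distinct edges with a common vertex are colored differently. Then the number $\chi'_3(G)$ of Tait colorings of $G$ satisfies $$\chi'_3(G)\le 3\cdot 2^{\,n-1}.$$ -/

import Mathlib

namespace SimpleGraph

/-- A drawing of a simple graph in the Euclidean plane without crossings: distinct vertices are
distinct points, every edge is a simple arc between its end vertices (the two orientations of an
edge give the same arc), an arc meets no vertices other than its end vertices, and two arcs of
distinct edges have no points in common except vertices. -/
structure PlaneEmbedding {V : Type*} (G : SimpleGraph V) where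
  /-- The point that represents a vertex. -/
  point : V → EuclideanSpace ℝ (Fin 2)
  point_injective : Function.Injective point
  /-- The arc that represents an edge, run through from the first to the second end vertex. -/
  arc : (d : G.Dart) → _root_.Path (point d.fst) (point d.snd)
  arc_injective : ∀ d : G.Dart, Function.Injective (arc d)
  arc_symm : ∀ d : G.Dart, Set.range (arc d.symm) = Set.range (arc d)
  eq_or_eq_of_mem_arc : ∀ (d : G.Dart) (w : V), point w ∈ Set.range (arc d) →
    w = d.fst ∨ w = d.snd
  mem_vertices_of_mem_arcs : ∀ d d' : G.Dart, d.edge ≠ d'.edge →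
    ∀ x ∈ Set.range (arc d), x ∈ Set.range (arc d') → x ∈ Set.range point

/-- A graph is planar if it can be drawn in the plane without crossings. -/
def IsPlanar {V : Type*} (G : SimpleGraph V) : Prop :=
  Nonempty G.PlaneEmbedding

/-- A graph is biconnected (2-connected) if it has more than two vertices, is connected, and
remains connected after the deletion of any one vertex. -/
def IsBiconnected {V : Type*} [Fintype V] (G : SimpleGraph V) : Prop :=
  2 < Fintype.card V ∧ G.Connected ∧ ∀ v : V, (G.induce {v}ᶜ).Connected

/-- A Tait coloring: a coloring of the edges in three colors such that any two distinct edges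
with a common vertex have different colors. -/
def TaitColoring {V : Type*} (G : SimpleGraph V) : Type _ :=
  {c : G.edgeSet → Fin 3 //
    ∀ e f : G.edgeSet, e ≠ f → (∃ v : V, v ∈ (e : Sym2 V) ∧ v ∈ (f : Sym2 V)) → c e ≠ c f}

end SimpleGraph

/-! Read colors as residues mod 3. The three colors at a vertex sum to 0, so colorings lie in the
kernel of `vertexSum`. Nonbipartiteness makes that map onto (`vertexSum_surjective`), so the kernel
has dimension 3n - 2n = n. It contains the constants; fixing the color of one edge `e` (3 ways)
leaves dimension n - 1. Differences over adjacent edges are functionals with trivial common kernel,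
so some n - 1 of them form a basis of the dual. On a coloring each is nonzero, hence 1 or 2: at most
2^(n-1) choices. -/

open Module

/-- If a family of linear functionals has trivial common kernel, then the vectors at which all of
them take values in a finite set `S` number at most `S.card ^ finrank K W`. -/
theorem card_forall_apply_mem_le {K W ι : Type*} [Field K] [AddCommGroup W] [Module K W]
    [FiniteDimensional K W] (φ : ι → Dual K W) (hφ : ∀ w, (∀ i, φ i w = 0) → w = 0)
    (S : Finset K) :
    Finite {w : W // ∀ i, φ i w ∈ S} ∧
      Nat.card {w : W // ∀ i, φ i w ∈ S} ≤ S.card ^ finrank K W := by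
  have hspan : Submodule.span K (Set.range φ) = ⊤ := by
    have h := Subspace.dualCoannihilator_dualAnnihilator_eq
      (W := Submodule.span K (Set.range φ))
    have h0 : (Submodule.span K (Set.range φ)).dualCoannihilator = ⊥ := by
      rw [eq_bot_iff]
      intro w hw
      rw [Submodule.mem_dualCoannihilator] at hw
      exact hφ w fun i => hw _ (Submodule.subset_span ⟨i, rfl⟩)
    rw [← h, h0, Submodule.dualAnnihilator_bot]
  -- A basis of the dual chosen inside the family: its values determine a vector.
  obtain ⟨b, hb, hbspan, hbli⟩ := exists_linearIndependent K (Set.range φ)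
  rw [hspan] at hbspan
  have : Finite b := hbli.finite
  have : Fintype b := Fintype.ofFinite b
  let B : Basis b K (Dual K W) := Basis.mk hbli (by simp [hbspan])
  have hcard : Nat.card b = finrank K W := by
    rw [← Subspace.dual_finrank_eq, finrank_eq_card_basis B, Nat.card_eq_fintype_card]
  have hmem : ∀ (w : {w : W // ∀ i, φ i w ∈ S}) (f : b), f.1 w.1 ∈ S := by
    intro w f
    obtain ⟨i, hi⟩ := hb f.2
    rw [← hi]
    exact w.2 i
  let F : {w : W // ∀ i, φ i w ∈ S} → (b → S) := fun w f => ⟨f.1 w.1, hmem w f⟩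
  have hF : Function.Injective F := by
    intro w w' h
    apply Subtype.ext
    rw [← sub_eq_zero, ← Module.forall_dual_apply_eq_zero_iff K]
    intro f
    have hf : f ∈ Submodule.span K b := hbspan ▸ Submodule.mem_top
    induction hf using Submodule.span_induction with
    | mem g hg =>
      have := congrArg Subtype.val (congrFun h ⟨g, hg⟩)
      simpa [F, sub_eq_zero] using this
    | zero => simp
    | add g g' _ _ hg hg' => simp only [LinearMap.add_apply, hg, hg', add_zero]
    | smul a g _ hg => simp only [LinearMap.smul_apply, hg, smul_zero]
  refine ⟨Finite.of_injective F hF, (Nat.card_le_card_of_injective F hF).trans ?_⟩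
  simp only [Nat.card_fun, hcard, Nat.card_eq_fintype_card, Fintype.card_coe, le_refl]

namespace SimpleGraph

variable {V : Type*} {G : SimpleGraph V}

/-- Such a `y` flips sign along every edge, so a nonzero one would give a 2-coloring by sign. -/
theorem eq_zero_of_adj_add_eq_zero {K : Type*} [Field K] (h2 : (2 : K) ≠ 0)
    (hconn : G.Connected) (hbip : ¬ G.IsBipartite) (y : V → K)
    (hy : ∀ u v, G.Adj u v → y u + y v = 0) : y = 0 := by
  by_contra hne
  obtain ⟨u, hu⟩ := Function.ne_iff.mp hne
  simp only [Pi.zero_apply] at hu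
  have hpm : ∀ v, y v = y u ∨ y v = - y u := by
    intro v
    obtain ⟨p⟩ := hconn.preconnected v u
    induction p with
    | nil => exact Or.inl rfl
    | cons h _ ih =>
      have h' := eq_neg_of_add_eq_zero_left (hy _ _ h)
      rcases ih hu with h1 | h1
      · exact Or.inr (by rw [h', h1])
      · exact Or.inl (by rw [h', h1, neg_neg])
  have hnn : y u ≠ - y u := by
    intro h
    have : 2 * y u = 0 := by linear_combination h
    exact (mul_ne_zero h2 hu) this
  classical
  refine hbip ⟨Coloring.mk (fun v => if y v = y u then 0 else 1) ?_⟩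
  intro a b hab
  have h' := eq_neg_of_add_eq_zero_left (hy _ _ hab)
  rcases hpm b with h1 | h1
  · rw [h1] at h'
    simp [h1, h', hnn.symm]
  · rw [h1, neg_neg] at h'
    simp [h1, h', hnn.symm]

/-- On a connected graph, edge weights that agree on edges with a common vertex are constant. -/
theorem eq_of_eq_at_vertices {K : Type*} (hconn : G.Connected) (c : G.edgeSet → K)
    (hc : ∀ e f : G.edgeSet, (∃ v : V, v ∈ (e : Sym2 V) ∧ v ∈ (f : Sym2 V)) → c e = c f)
    (e f : G.edgeSet) : c e = c f := by
  have key : ∀ u v, G.Walk u v → u ∈ (e : Sym2 V) →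
      ∀ g : G.edgeSet, v ∈ (g : Sym2 V) → c e = c g := by
    intro u v p
    induction p generalizing e with
    | nil => exact fun hu g hg => hc _ _ ⟨_, hu, hg⟩
    | @cons a b _ h p ih =>
      intro hu g hg
      exact (hc e ⟨s(a, b), h⟩ ⟨a, hu, by simp⟩).trans (ih _ (by simp) g hg)
  obtain ⟨p⟩ := hconn.preconnected (e : Sym2 V).out.1 (f : Sym2 V).out.1
  exact key _ _ p (Sym2.out_fst_mem _) f (Sym2.out_fst_mem _)

theorem two_mul_card_edgeSet [Fintype V] [DecidableRel G.Adj] {d : ℕ} (hreg : G.IsRegularOfDegree d) :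
    2 * Fintype.card G.edgeSet = Fintype.card V * d := by
  rw [← edgeFinset_card, ← sum_degrees_eq_twice_card_edges,
    Finset.sum_congr rfl fun v _ => hreg v]
  simp

/-- The colors of a Tait coloring, as residues modulo 3. -/
def TaitColoring.weight (c : G.TaitColoring) : G.edgeSet → ZMod 3 := c.1

theorem TaitColoring.weight_injective :
    Function.Injective (TaitColoring.weight (G := G)) :=
  Subtype.val_injective

theorem TaitColoring.weight_ne (c : G.TaitColoring) {e f : G.edgeSet} (hef : e ≠ f)
    (h : ∃ v : V, v ∈ (e : Sym2 V) ∧ v ∈ (f : Sym2 V)) : c.weight e ≠ c.weight f :=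
  c.2 e f hef h

variable [Fintype V] [DecidableEq V] (G) [DecidableRel G.Adj]

/-- The edges at a vertex. -/
def edgesAt (v : V) : Finset G.edgeSet :=
  Finset.univ.filter fun e => v ∈ (e : Sym2 V)

@[simp]
theorem mem_edgesAt {v : V} {e : G.edgeSet} : e ∈ G.edgesAt v ↔ v ∈ (e : Sym2 V) := by
  simp [edgesAt]

theorem card_edgesAt (v : V) : (G.edgesAt v).card = G.degree v := by
  rw [← card_incidenceFinset_eq_degree, ← Finset.card_map (Function.Embedding.subtype _)]
  congr 1
  ext e
  simp [incidenceSet, and_comm]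

/-- The map that sends edge weights to the sums of the weights at the vertices. -/
def vertexSum (K : Type*) [Field K] : (G.edgeSet → K) →ₗ[K] (V → K) where
  toFun c v := ∑ e ∈ G.edgesAt v, c e
  map_add' c d := by ext v; simp [Finset.sum_add_distrib]
  map_smul' a c := by ext v; simp [Finset.mul_sum]

variable {G}

theorem vertexSum_apply {K : Type*} [Field K] (c : G.edgeSet → K) (v : V) :
    G.vertexSum K c v = ∑ e ∈ G.edgesAt v, c e := rfl

/-- By duality: a functional killed by the transpose has coefficients summing to 0 along each edge.
-/
theorem vertexSum_surjective {K : Type*} [Field K] (h2 : (2 : K) ≠ 0)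
    (hconn : G.Connected) (hbip : ¬ G.IsBipartite) :
    Function.Surjective (G.vertexSum K) := by
  rw [← LinearMap.dualMap_injective_iff, injective_iff_map_eq_zero]
  intro f hf
  have hy := eq_zero_of_adj_add_eq_zero h2 hconn hbip (fun v => f (Pi.single v 1)) (by
    intro u v huv
    let e : G.edgeSet := ⟨s(u, v), G.mem_edgeSet.mpr huv⟩
    have h := LinearMap.congr_fun hf (Pi.single e 1)
    have hsum : G.vertexSum K (Pi.single e 1) = Pi.single u 1 + Pi.single v 1 := by
      ext w
      have he : w ∈ (e : Sym2 V) ↔ w = u ∨ w = v := Sym2.mem_iff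
      simp only [vertexSum_apply, Pi.single_apply, Finset.sum_ite_eq', mem_edgesAt, he,
        Pi.add_apply]
      have := huv.ne
      by_cases hwu : w = u
      · subst hwu; simp [this]
      · by_cases hwv : w = v
        · subst hwv; simp [hwu]
        · simp [hwu, hwv]
    rw [LinearMap.dualMap_apply, hsum, map_add] at h
    exact h)
  refine LinearMap.pi_ext' fun v => LinearMap.ext_ring ?_
  exact congrFun hy v

theorem vertexSum_const (hcubic : G.IsRegularOfDegree 3) (a : ZMod 3) :
    G.vertexSum (ZMod 3) (fun _ => a) = 0 := by
  ext v
  rw [vertexSum_apply, Finset.sum_const, card_edgesAt, hcubic v]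
  exact (by decide : ∀ a : ZMod 3, 3 • a = 0) a

theorem TaitColoring.vertexSum_weight (hcubic : G.IsRegularOfDegree 3) (c : G.TaitColoring) :
    G.vertexSum (ZMod 3) c.weight = 0 := by
  ext v
  have hinj : Set.InjOn c.weight (G.edgesAt v) := by
    intro e he f hf h
    by_contra hne
    exact c.weight_ne hne
      ⟨v, by simpa using he, by simpa using hf⟩ h
  have himage : (G.edgesAt v).image c.weight = Finset.univ := by
    rw [← Finset.card_eq_iff_eq_univ, Finset.card_image_of_injOn hinj, card_edgesAt, hcubic v,
      ZMod.card]
  rw [vertexSum_apply, ← Finset.sum_image (f := fun a : ZMod 3 => a) hinj, himage]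
  exact (by decide : ∑ a : ZMod 3, a = 0)

/-- The edge weights modulo 3 that sum to 0 at every vertex and vanish at `e`. -/
def balancedWeights (e : G.edgeSet) : Submodule (ZMod 3) (G.edgeSet → ZMod 3) :=
  LinearMap.ker ((G.vertexSum (ZMod 3)).prod (LinearMap.proj e))

theorem mem_balancedWeights {e : G.edgeSet} {w : G.edgeSet → ZMod 3} :
    w ∈ balancedWeights e ↔ G.vertexSum (ZMod 3) w = 0 ∧ w e = 0 := by
  simp [balancedWeights]

theorem finrank_balancedWeights {n : ℕ} (hcard : Fintype.card V = 2 * n)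
    (hcubic : G.IsRegularOfDegree 3) (hconn : G.Connected) (hbip : ¬ G.IsBipartite)
    (e : G.edgeSet) : finrank (ZMod 3) (balancedWeights e) = n - 1 := by
  have hsurj : Function.Surjective
      ((G.vertexSum (ZMod 3)).prod (LinearMap.proj (φ := fun _ => ZMod 3) e)) := by
    rintro ⟨y, t⟩
    obtain ⟨c, hc⟩ := vertexSum_surjective (K := ZMod 3) (by decide) hconn hbip y
    -- Constants have zero vertex sums, so this shift corrects only the value at `e`.
    refine ⟨c + fun _ => t - c e, ?_⟩
    refine Prod.ext ?_ ?_
    · change G.vertexSum (ZMod 3) (c + fun _ => t - c e) = y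
      rw [map_add, hc, vertexSum_const hcubic, add_zero]
    · simp
  have hrank := LinearMap.finrank_range_add_finrank_ker
    ((G.vertexSum (ZMod 3)).prod (LinearMap.proj (φ := fun _ => ZMod 3) e))
  rw [LinearMap.range_eq_top.mpr hsurj, finrank_top] at hrank
  simp only [finrank_prod, finrank_fintype_fun_eq_card, finrank_self] at hrank
  have hE := two_mul_card_edgeSet hcubic
  rw [balancedWeights]
  omega

/-- A connected nonbipartite cubic graph with `2 * n` vertices has at most `3 * 2 ^ (n - 1)`
Tait colorings. -/
theorem card_taitColoring_le {n : ℕ} (hcard : Fintype.card V = 2 * n)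
    (hcubic : G.IsRegularOfDegree 3) (hconn : G.Connected) (hbip : ¬ G.IsBipartite) :
    Nat.card G.TaitColoring ≤ 3 * 2 ^ (n - 1) := by
  obtain ⟨v⟩ := hconn.nonempty
  obtain ⟨e, -⟩ : (G.edgesAt v).Nonempty := by
    rw [← Finset.card_pos, card_edgesAt, hcubic v]
    norm_num
  let ι := {p : G.edgeSet × G.edgeSet //
    p.1 ≠ p.2 ∧ ∃ v : V, v ∈ (p.1 : Sym2 V) ∧ v ∈ (p.2 : Sym2 V)}
  let φ : ι → Dual (ZMod 3) (balancedWeights e) := fun p =>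
    (LinearMap.proj (R := ZMod 3) (φ := fun _ => ZMod 3) p.1.1 -
      LinearMap.proj (φ := fun _ => ZMod 3) p.1.2) ∘ₗ (balancedWeights e).subtype
  have hφ_apply : ∀ p w, φ p w = w.1 p.1.1 - w.1 p.1.2 := fun _ _ => rfl
  have hφ : ∀ w, (∀ i, φ i w = 0) → w = 0 := by
    intro w hw
    ext f
    refine (eq_of_eq_at_vertices hconn w.1 (fun a b hab => ?_) f e).trans
      (mem_balancedWeights.mp w.2).2
    by_cases h : a = b
    · rw [h]
    · exact sub_eq_zero.mp (hw ⟨(a, b), h, hab⟩)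
  obtain ⟨hfin, hle⟩ := card_forall_apply_mem_le φ hφ {1, 2}
  have hpm : ∀ x y : ZMod 3, x ≠ y → x - y ∈ ({1, 2} : Finset (ZMod 3)) := by decide
  -- Subtracting the color of `e` preserves all differences between edges.
  let F : G.TaitColoring →
      ZMod 3 × {w : balancedWeights e // ∀ i, φ i w ∈ ({1, 2} : Finset (ZMod 3))} := fun c =>
    (c.weight e, ⟨⟨c.weight - fun _ => c.weight e, mem_balancedWeights.mpr
      ⟨by rw [map_sub, c.vertexSum_weight hcubic, vertexSum_const hcubic, sub_zero], by simp⟩⟩,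
      fun p => by
        rw [hφ_apply]
        simpa only [Pi.sub_apply, sub_sub_sub_cancel_right] using
          hpm _ _ (c.weight_ne p.2.1 p.2.2)⟩)
  have hF : Function.Injective F := by
    intro c d h
    have h1 : c.weight e = d.weight e := congrArg Prod.fst h
    have h2 : (c.weight - fun _ => c.weight e) = d.weight - fun _ => d.weight e :=
      congrArg (fun x => x.2.1.1) h
    rw [h1] at h2
    exact TaitColoring.weight_injective (sub_left_injective h2)
  refine (Nat.card_le_card_of_injective F hF).trans ?_
  rw [Nat.card_prod, Nat.card_zmod, ← finrank_balancedWeights hcard hcubic hconn hbip e]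
  exact Nat.mul_le_mul_left 3 hle

end SimpleGraph

theorem corollary1 {V : Type*} [Fintype V] [DecidableEq V] (G : SimpleGraph V)
    [DecidableRel G.Adj] (n : ℕ) (hcard : Fintype.card V = 2 * n)
    (hcubic : G.IsRegularOfDegree 3) (hbiconnected : G.IsBiconnected) (hplanar : G.IsPlanar)
    (hnonbipartite : ¬ G.IsBipartite) :
    Nat.card G.TaitColoring ≤ 3 * 2 ^ (n - 1) :=
  SimpleGraph.card_taitColoring_le hcard hcubic hbiconnected.2.1 hnonbipartite
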